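/- For a real number $x$ let $\|x\|$ denote the distance from $x$ to the nearest integer, and for real numbers $\theta,\phi$ let \[ L(\theta,\phi)=\liminf_{|q|\to\infty}\ \{\,|q|\,\|q\theta-\phi\| : q\in\mathbb{Z}\,\}\in[0,\infty] \] be the inhomogeneous approximation constant. Let $s$ be a positive integer, and let $n_1,n_2$ be relatively prime nonzero integers. If $L(e^{1/s},1/n_1)=L(e^{1/s},1/n_2)=0$, then $L(e^{1/s},1/(n_1n_2))=0$. -/

import Mathlib

/-- The distance `‖x‖` from the real number `x` to the nearest integer. -/
noncomputable def distNearestInt (x : ℝ) : ℝ := |x - (round x : ℝ)|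

/-- The inhomogeneous approximation constant
`L(θ, φ) = liminf_{|q| → ∞} |q| ‖q θ - φ‖`, with `q` running over all integers.
The terms are nonnegative reals; the lower limit is taken in `[0, ∞]`, so that it is the
true lower limit even when the terms are unbounded. -/
noncomputable def inhomApproxConst (θ φ : ℝ) : ENNReal :=
  Filter.liminf (fun q : ℤ => ENNReal.ofReal (|(q : ℝ)| * distNearestInt ((q : ℝ) * θ - φ)))
    (Filter.comap (fun q : ℤ => |q|) Filter.atTop)

open Filter Topology Finset

/-! Write `N_j / D_j` for the diagonal Padé approximants of `θ = exp (1 / s)`. The constant at `1 /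
n` vanishes exactly when `n` divides some `D_j`. If `q` is a very good solution, the fraction `(n p
+ 1) / (n q)` is so close to `θ` that it equals some `N_j / D_j`; its numerator is prime to `n`, so
`n ∣ D_j` (`exists_dvd_padeDen`). Conversely, if `n ∣ D_j` for arbitrarily large `j`, multiplying
`D_j / n` by an inverse of `N_j` mod `n` gives good solutions, because `D_{j+1} / D_j → ∞`
(`inhomApproxConst_eq_zero_of_dvd_padeDen`). Up to sign, `D_j` mod `n` is periodic in `j` with
period `|n|` (`besselVal_add_modEq`), so the Chinese remainder theorem on the index `j` combines
divisibility by `n₁` and by `n₂`. -/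

/-! ### Bessel polynomials: three-term recurrence -/

/-- The coefficient `(j + k)! / (k! (j - k)!)` of the `j`-th Bessel polynomial. -/
def besselCoeff (j k : ℕ) : ℕ := (2 * k).descFactorial k * (j + k).choose (2 * k)

/-- The Bessel polynomials `∑ k, (j + k)! / (k! (j - k)!) x ^ k`, whose values at `s` and `-s` are,
up to sign, the numerators and denominators of the diagonal Padé approximants of `exp (1 / s)`. -/
def besselVal (x : ℤ) (j : ℕ) : ℤ := ∑ k ∈ range (j + 1), (besselCoeff j k : ℤ) * x ^ k

lemma besselCoeff_zero_right (j : ℕ) : besselCoeff j 0 = 1 := by simp [besselCoeff]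

lemma besselCoeff_eq_zero {j k : ℕ} (h : j < k) : besselCoeff j k = 0 := by
  rw [besselCoeff, Nat.choose_eq_zero_of_lt (by omega), mul_zero]

lemma besselVal_eq_sum_range (x : ℤ) {j M : ℕ} (h : j + 1 ≤ M) :
    besselVal x j = ∑ k ∈ range M, (besselCoeff j k : ℤ) * x ^ k := by
  refine sum_subset (range_mono h) fun k _ hk => ?_
  rw [besselCoeff_eq_zero (by simpa using hk)]
  simp

lemma descFactorial_two_mul_succ (k : ℕ) :
    (2 * (k + 1)).descFactorial (k + 1) = 2 * (2 * k + 1) * (2 * k).descFactorial k := by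
  have h1 := Nat.factorial_mul_descFactorial (show k + 1 ≤ 2 * (k + 1) by omega)
  have h2 := Nat.factorial_mul_descFactorial (show k ≤ 2 * k by omega)
  rw [show 2 * (k + 1) - (k + 1) = k + 1 by omega] at h1
  rw [show 2 * k - k = k by omega] at h2
  rw [show 2 * (k + 1) = 2 * k + 1 + 1 by ring] at h1 ⊢
  rw [Nat.factorial_succ (2 * k + 1), Nat.factorial_succ (2 * k), Nat.factorial_succ k, ← h2] at h1
  have : 0 < (k + 1) * k.factorial := by positivity
  refine Nat.eq_of_mul_eq_mul_left this ?_
  rw [h1]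
  ring

lemma besselCoeff_rec (j k : ℕ) :
    besselCoeff (j + 2) (k + 1) =
      2 * (2 * j + 3) * besselCoeff (j + 1) k + besselCoeff j (k + 1) := by
  simp only [besselCoeff, descFactorial_two_mul_succ]
  have e1 : (j + 2 + (k + 1)).choose (2 * (k + 1)) = (j + k + 1).choose (2 * k)
      + 2 * (j + k + 1).choose (2 * k + 1) + (j + k + 1).choose (2 * k + 2) := by
    rw [show j + 2 + (k + 1) = j + k + 1 + 1 + 1 by ring, show 2 * (k + 1) = 2 * k + 1 + 1 by ring,
      Nat.choose_succ_succ, Nat.choose_succ_succ, Nat.choose_succ_succ (j + k + 1) (2 * k + 1)]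
    ring
  have e2 : (j + k + 1).choose (2 * k + 1) * (2 * k + 1) + (j + k + 1).choose (2 * k) * (2 * k)
      = (j + k + 1).choose (2 * k) * (j + k + 1) := by
    rw [Nat.choose_succ_right_eq]
    rcases le_or_gt (2 * k) (j + k + 1) with h | h
    · rw [← mul_add, Nat.sub_add_cancel h]
    · simp [Nat.choose_eq_zero_of_lt h]
  rw [e1, show j + 1 + k = j + k + 1 by ring, show j + (k + 1) = j + k + 1 by ring,
    show 2 * (k + 1) = 2 * k + 2 by ring]
  zify at e2 ⊢
  linear_combination (4 * ((2 * k).descFactorial k : ℤ)) * e2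

lemma besselVal_rec (x : ℤ) (j : ℕ) :
    besselVal x (j + 2) = 2 * (2 * j + 3) * x * besselVal x (j + 1) + besselVal x j := by
  rw [besselVal, besselVal, besselVal_eq_sum_range x (show j + 1 ≤ j + 2 + 1 by omega),
    sum_range_succ', sum_range_succ' _ (j + 2), mul_sum, ← add_assoc, ← sum_add_distrib]
  simp only [besselCoeff_zero_right]
  congr 1
  refine sum_congr rfl fun k _ => ?_
  rw [besselCoeff_rec]
  push_cast
  ring

/-! ### Periodicity in the index modulo `n` -/

lemma dvd_descFactorial_two_mul {i k : ℕ} (hi : 0 < i) (h : i ≤ 2 * k) :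
    i ∣ (2 * k).descFactorial k := by
  rcases le_or_gt i k with h' | h'
  · exact (Nat.dvd_factorial hi h').trans (Nat.factorial_dvd_descFactorial _ _)
  · rw [Nat.descFactorial_eq_prod_range]
    have := dvd_prod_of_mem (fun l => 2 * k - l) (mem_range.2 (show 2 * k - i < k by omega))
    rwa [show 2 * k - (2 * k - i) = i by omega] at this

/-- Vandermonde expands the binomial; in every term but the one giving `besselCoeff j k`, a factor
`i + 1` of the descending factorial turns `n.choose (i + 1)` into a multiple of `n`. -/
lemma besselCoeff_add_modEq (n j k : ℕ) : besselCoeff (j + n) k ≡ besselCoeff j k [MOD n] := by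
  rcases n.eq_zero_or_pos with rfl | hn
  · rfl
  have : besselCoeff (j + n) k = (2 * k).descFactorial k *
      ∑ i ∈ range (2 * k), n.choose (i + 1) * (j + k).choose (2 * k - (i + 1))
      + besselCoeff j k := by
    rw [besselCoeff, besselCoeff, show j + n + k = n + (j + k) by ring, Nat.add_choose_eq,
      Nat.sum_antidiagonal_eq_sum_range_succ
        (fun a b => n.choose a * (j + k).choose b), sum_range_succ']
    simp [mul_add]
  rw [this]
  refine (Nat.ModEq.add_right _ ((Nat.modEq_zero_iff_dvd).2 ?_)).trans (by rw [zero_add])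
  rw [mul_sum]
  refine dvd_sum fun i hi => ?_
  obtain ⟨c, hc⟩ := dvd_descFactorial_two_mul (Nat.succ_pos i) (mem_range.1 hi : i + 1 ≤ 2 * k)
  obtain ⟨m, rfl⟩ := Nat.exists_eq_succ_of_ne_zero hn.ne'
  have := Nat.add_one_mul_choose_eq m i
  refine ⟨c * m.choose i * (j + k).choose (2 * k - (i + 1)), ?_⟩
  rw [hc]
  calc _ = c * ((m + 1).choose (i + 1) * (i + 1)) * (j + k).choose (2 * k - (i + 1)) := by
        simp only [Nat.succ_eq_add_one]; ring
    _ = _ := by rw [← this]; simp only [Nat.succ_eq_add_one]; ring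

lemma besselVal_add_modEq (x : ℤ) (n j : ℕ) :
    besselVal x (j + n) ≡ besselVal x j [ZMOD n] := by
  rw [besselVal, besselVal_eq_sum_range x (show j + 1 ≤ j + n + 1 by omega)]
  exact Int.ModEq.sum fun k _ =>
    ((Int.natCast_modEq_iff).2 (besselCoeff_add_modEq n j k)).mul_right _

lemma dvd_besselVal_add_mul {x n : ℤ} {j : ℕ} (h : n ∣ besselVal x j) (t : ℕ) :
    n ∣ besselVal x (j + n.natAbs * t) := by
  induction t with
  | zero => simpa using h
  | succ t ih =>
    have := besselVal_add_modEq x n.natAbs (j + n.natAbs * t)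
    rw [mul_add, mul_one, ← add_assoc]
    rw [← Int.natAbs_dvd] at ih ⊢
    exact (Int.ModEq.dvd_iff this).2 ih

/-! ### Padé numerators and denominators: determinant and growth -/

/-- The denominator of the `j`-th diagonal Padé approximant of `exp (1 / s)`. -/
def padeDen (s j : ℕ) : ℤ := (-1) ^ j * besselVal (-s) j

/-- The numerator of the `j`-th diagonal Padé approximant of `exp (1 / s)`. -/
def padeNum (s j : ℕ) : ℤ := besselVal s j

lemma dvd_padeDen_iff {s j : ℕ} {n : ℤ} : n ∣ padeDen s j ↔ n ∣ besselVal (-s) j := by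
  rcases neg_one_pow_eq_or ℤ j with h | h <;> simp [padeDen, h]

lemma padeNum_rec (s j : ℕ) :
    padeNum s (j + 2) = 2 * (2 * j + 3) * s * padeNum s (j + 1) + padeNum s j :=
  besselVal_rec s j

lemma padeDen_rec (s j : ℕ) :
    padeDen s (j + 2) = 2 * (2 * j + 3) * s * padeDen s (j + 1) + padeDen s j := by
  rw [padeDen, padeDen, padeDen, besselVal_rec]
  ring

lemma besselVal_zero (x : ℤ) : besselVal x 0 = 1 := by
  simp [besselVal, besselCoeff]

lemma besselVal_one (x : ℤ) : besselVal x 1 = 1 + 2 * x := by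
  simp [besselVal, besselCoeff, sum_range_succ]

lemma padeNum_odd (s j : ℕ) : Odd (padeNum s j) := by
  induction j using Nat.twoStepInduction with
  | zero => simp [padeNum, besselVal_zero]
  | one => exact ⟨s, by rw [padeNum, besselVal_one]; ring⟩
  | more j h _ =>
    rw [padeNum_rec]
    refine Even.add_odd ⟨(2 * j + 3) * s * padeNum s (j + 1), by ring⟩ h

lemma padeNum_mul_padeDen_sub (s j : ℕ) :
    padeNum s (j + 1) * padeDen s j - padeNum s j * padeDen s (j + 1) = 2 * (-1) ^ j := by
  induction j with
  | zero =>
    simp [padeNum, padeDen, besselVal_zero, besselVal_one]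
    ring
  | succ j ih =>
    rw [padeNum_rec, padeDen_rec, pow_succ]
    linear_combination -ih

/-- By the determinant identity a common divisor divides 2, and the numerator is odd. -/
lemma isCoprime_padeNum {s j : ℕ} {n : ℤ} (h : n ∣ padeDen s j) : IsCoprime (padeNum s j) n := by
  refine IsCoprime.of_isCoprime_of_dvd_right ?_ h
  obtain ⟨c, hc⟩ := padeNum_odd s j
  have := padeNum_mul_padeDen_sub s j
  rcases neg_one_pow_eq_or ℤ j with e | e <;> rw [e] at this
  · exact ⟨1 + c * padeDen s (j + 1), -c * padeNum s (j + 1), by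
      linear_combination hc - c * this⟩
  · exact ⟨1 - c * padeDen s (j + 1), c * padeNum s (j + 1), by
      linear_combination hc + c * this⟩

lemma padeDen_pos_and_le_succ {s : ℕ} (hs : 0 < s) (j : ℕ) :
    0 < padeDen s j ∧ padeDen s j ≤ padeDen s (j + 1) := by
  have hs' : (1 : ℤ) ≤ s := by exact_mod_cast hs
  induction j with
  | zero =>
    simp only [padeDen, besselVal_zero, besselVal_one, zero_add]
    constructor <;> norm_num
    linarith
  | succ j ih =>
    have h : 0 < padeDen s (j + 1) := ih.1.trans_le ih.2
    refine ⟨h, ?_⟩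
    rw [padeDen_rec]
    have : (1 : ℤ) * 1 ≤ (2 * (2 * j + 3)) * s := by
      apply mul_le_mul <;> linarith [Int.natCast_nonneg j]
    linarith [mul_le_mul_of_nonneg_right this h.le, ih.1]

lemma padeDen_pos {s : ℕ} (hs : 0 < s) (j : ℕ) : 0 < padeDen s j :=
  (padeDen_pos_and_le_succ hs j).1

lemma padeDen_growth {s : ℕ} (hs : 0 < s) (j : ℕ) :
    (j + 2) * padeDen s (j + 1) ≤ padeDen s (j + 2) := by
  have hs' : (1 : ℤ) ≤ s := by exact_mod_cast hs
  have h := padeDen_pos hs (j + 1)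
  rw [padeDen_rec]
  have h2 := padeDen_pos hs j
  have : ((j : ℤ) + 2) * 1 ≤ (2 * (2 * j + 3)) * s := by
    apply mul_le_mul <;> linarith [Int.natCast_nonneg j]
  nlinarith

lemma padeDen_ge {s : ℕ} (hs : 0 < s) (j : ℕ) : (j : ℤ) ≤ padeDen s j := by
  match j with
  | 0 => exact (padeDen_pos hs 0).le
  | 1 => exact padeDen_pos hs 1
  | j + 2 =>
    have := padeDen_growth hs j
    have h := padeDen_pos hs (j + 1)
    push_cast
    nlinarith

/-! ### Convergence to `exp (1 / s)` with an error bound -/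

lemma besselCoeff_sub {i j : ℕ} (h : i ≤ j) :
    (besselCoeff j (j - i) : ℝ) = (2 * j).descFactorial j *
      ((j.descFactorial i / (2 * j).descFactorial i : ℝ) / i.factorial) := by
  obtain ⟨k, rfl⟩ := Nat.exists_eq_add_of_le h
  have h1 := Nat.factorial_mul_descFactorial (show k ≤ 2 * k by omega)
  have h2 := Nat.choose_mul_factorial_mul_factorial (show 2 * k ≤ i + k + k by omega)
  have h3 := Nat.factorial_mul_descFactorial (show i + k ≤ 2 * (i + k) by omega)
  have h4 := Nat.factorial_mul_descFactorial (show i ≤ i + k by omega)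
  have h5 := Nat.factorial_mul_descFactorial (show i ≤ 2 * (i + k) by omega)
  rw [show 2 * k - k = k by omega] at h1
  rw [show i + k + k - 2 * k = i by omega] at h2
  rw [show 2 * (i + k) - (i + k) = i + k by omega] at h3
  rw [show i + k - i = k by omega] at h4 ⊢
  rw [show 2 * (i + k) - i = i + k + k by omega] at h5
  have p : ((2 * (i + k)).descFactorial i : ℝ) ≠ 0 := by
    exact_mod_cast (Nat.descFactorial_pos.2 (by omega)).ne'
  have q := Nat.factorial_ne_zero
  rw [besselCoeff, ← mul_div_assoc, ← mul_div_assoc, div_div, eq_div_iff (by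
    exact mul_ne_zero p (by exact_mod_cast q i))]
  norm_cast
  have q' : (i + k).factorial * k.factorial * (2 * k).factorial ≠ 0 := by simp [q]
  refine Nat.eq_of_mul_eq_mul_left (Nat.pos_of_ne_zero q') ?_
  calc _ = (k.factorial * (2 * k).descFactorial k) *
        ((i + k + k).choose (2 * k) * (2 * k).factorial * i.factorial) *
        ((i + k).factorial * (2 * (i + k)).descFactorial i) := by ring
    _ = (2 * k).factorial * ((i + k + k).factorial * (2 * (i + k)).descFactorial i) *
        (i + k).factorial := by rw [h1, h2]; ring
    _ = (2 * k).factorial * ((i + k).factorial * (2 * (i + k)).descFactorial (i + k)) *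
        (k.factorial * (i + k).descFactorial i) := by rw [h5, ← h3, h4]
    _ = _ := by ring

lemma tendsto_descFactorial_div (i : ℕ) :
    Tendsto (fun j : ℕ => (j.descFactorial i / (2 * j).descFactorial i : ℝ)) atTop
      (𝓝 ((1 / 2) ^ i)) := by
  induction i with
  | zero => simp
  | succ i ih =>
    have key : Tendsto (fun j : ℕ => (j - i : ℝ) / (2 * j - i)) atTop (𝓝 (1 / 2)) := by
      have h0 : Tendsto (fun j : ℕ => (i : ℝ) / j) atTop (𝓝 0) :=
        tendsto_const_div_atTop_nhds_zero_nat _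
      have := (h0.const_sub 1).div (h0.const_sub 2) (by norm_num)
      rw [sub_zero, sub_zero] at this
      refine this.congr' ?_
      filter_upwards [eventually_gt_atTop 0] with j hj
      have hj' : (j : ℝ) ≠ 0 := by exact_mod_cast hj.ne'
      simp only [Pi.div_apply]
      rw [← mul_div_mul_right _ _ hj', sub_mul, sub_mul, div_mul_cancel₀ _ hj', one_mul]
    rw [pow_succ']
    refine (key.mul ih).congr' ?_
    filter_upwards [eventually_ge_atTop i] with j hj
    rw [Nat.descFactorial_succ, Nat.descFactorial_succ]
    push_cast [Nat.cast_sub hj, Nat.cast_sub (show i ≤ 2 * j by omega)]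
    rw [mul_div_mul_comm]

lemma descFactorial_div_le_one (i j : ℕ) :
    (j.descFactorial i / (2 * j).descFactorial i : ℝ) ≤ 1 := by
  refine div_le_one_of_le₀ ?_ (by positivity)
  exact_mod_cast Nat.descFactorial_le i (by omega)

lemma besselVal_eq_mul_tsum {x : ℤ} (hx : x ≠ 0) (j : ℕ) :
    (besselVal x j : ℝ) = (2 * j).descFactorial j * (x : ℝ) ^ j *
      ∑' i : ℕ, (j.descFactorial i / (2 * j).descFactorial i : ℝ) *
        ((1 / (x : ℝ)) ^ i / i.factorial) := by
  have hx' : (x : ℝ) ≠ 0 := by exact_mod_cast hx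
  rw [tsum_eq_sum (s := range (j + 1)) (fun i hi => by
    rw [Nat.descFactorial_of_lt (by simpa using hi)]; simp), besselVal, ← sum_range_reflect,
    mul_sum]
  push_cast
  refine sum_congr rfl fun i hi => ?_
  have hi' : i ≤ j := Nat.lt_succ_iff.1 (mem_range.1 hi)
  rw [besselCoeff_sub hi', ← pow_sub_mul_pow (x : ℝ) hi', one_div, inv_pow]
  field_simp

/-- Summed from the top coefficient down, the normalized polynomial tends termwise to the series of
`exp (1 / (2 x))`, dominated by that of `exp |1 / x|`. The quotient of the cases `x = s` and `x =
-s` then tends to `exp (1 / s)`. -/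
lemma tendsto_besselVal_div {x : ℤ} (hx : x ≠ 0) :
    Tendsto (fun j : ℕ => (besselVal x j : ℝ) / ((2 * j).descFactorial j * (x : ℝ) ^ j)) atTop
      (𝓝 (Real.exp (1 / (2 * x)))) := by
  have hx' : (x : ℝ) ≠ 0 := by exact_mod_cast hx
  have hexp : Real.exp (1 / (2 * x)) =
      ∑' i : ℕ, (1 / 2 : ℝ) ^ i * ((1 / (x : ℝ)) ^ i / i.factorial) := by
    rw [Real.exp_eq_exp_ℝ, NormedSpace.exp_eq_tsum_div]
    refine tsum_congr fun i => ?_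
    rw [← mul_div_assoc, ← mul_pow, one_div_mul_one_div]
  rw [hexp]
  refine Tendsto.congr (fun j => ?_) (tendsto_tsum_of_dominated_convergence
    (bound := fun i : ℕ => |1 / (x : ℝ)| ^ i / i.factorial)
    (Real.summable_pow_div_factorial _)
    (fun i => (tendsto_descFactorial_div i).mul_const _)
    (Eventually.of_forall fun j i => ?_))
  · have h : ((2 * j).descFactorial j : ℝ) ≠ 0 := by
      exact_mod_cast (Nat.descFactorial_pos.2 (by omega)).ne'
    rw [besselVal_eq_mul_tsum hx, mul_div_cancel_left₀ _ (mul_ne_zero h (pow_ne_zero _ hx'))]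
  · rw [norm_mul, Real.norm_of_nonneg (by positivity), norm_div, norm_pow, Real.norm_eq_abs,
      Real.norm_of_nonneg (by positivity : (0 : ℝ) ≤ i.factorial)]
    exact mul_le_of_le_one_left (by positivity) (descFactorial_div_le_one i j)

lemma tendsto_padeNum_div_padeDen {s : ℕ} (hs : 0 < s) :
    Tendsto (fun j => (padeNum s j / padeDen s j : ℝ)) atTop (𝓝 (Real.exp (1 / s))) := by
  have hs' : (s : ℤ) ≠ 0 := by exact_mod_cast hs.ne'
  have hs'' : (s : ℝ) ≠ 0 := by exact_mod_cast hs.ne'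
  have := (tendsto_besselVal_div hs').div (tendsto_besselVal_div (neg_ne_zero.2 hs'))
    (Real.exp_ne_zero _)
  rw [← Real.exp_sub] at this
  convert this using 2 with j
  · have h : ((2 * j).descFactorial j : ℝ) ≠ 0 := by
      exact_mod_cast (Nat.descFactorial_pos.2 (by omega)).ne'
    simp only [Pi.div_apply, padeNum, padeDen]
    push_cast
    rw [neg_pow (s : ℝ) j]
    rcases neg_one_pow_eq_or ℝ j with e | e <;> rw [e] <;> field_simp
  · congr 1
    push_cast
    field_simp
    norm_num

/-- Consecutive approximants differ by `2 / (D_i D_{i+1})`, and these products at least double, so a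
geometric series bounds the tail. -/
lemma abs_padeDen_mul_exp_sub_le {s : ℕ} (hs : 0 < s) (j : ℕ) :
    |padeDen s j * Real.exp (1 / s) - padeNum s j| ≤ 4 / padeDen s (j + 1) := by
  have pos (i : ℕ) : (0 : ℝ) < padeDen s i := by exact_mod_cast padeDen_pos hs i
  have mono (i : ℕ) : (padeDen s i : ℝ) ≤ padeDen s (i + 1) := by
    exact_mod_cast (padeDen_pos_and_le_succ hs i).2
  have grow (i : ℕ) : 2 * (padeDen s i : ℝ) ≤ padeDen s (i + 2) := by
    have h : ((i : ℝ) + 2) * padeDen s (i + 1) ≤ padeDen s (i + 2) := by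
      exact_mod_cast padeDen_growth hs i
    have := mono i
    have := pos i
    nlinarith [Nat.cast_nonneg (α := ℝ) i]
  have hprod (t : ℕ) : 2 ^ t * ((padeDen s j : ℝ) * padeDen s (j + 1)) ≤
      padeDen s (j + t) * padeDen s (j + t + 1) := by
    induction t with
    | zero => simp
    | succ t ih =>
      have := mul_le_mul_of_nonneg_right (grow (j + t)) (pos (j + t + 1)).le
      rw [pow_succ, ← add_assoc]
      linarith
  have hdist (t : ℕ) : dist (padeNum s (j + t) / padeDen s (j + t) : ℝ)
      (padeNum s (j + (t + 1)) / padeDen s (j + (t + 1))) ≤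
      2 / (padeDen s j * padeDen s (j + 1)) * (1 / 2) ^ t := by
    have hdet : (padeNum s (j + t + 1) * padeDen s (j + t) -
        padeNum s (j + t) * padeDen s (j + t + 1) : ℝ) = 2 * (-1) ^ (j + t) := by
      exact_mod_cast padeNum_mul_padeDen_sub s (j + t)
    rw [← add_assoc, dist_comm, Real.dist_eq, div_sub_div _ _ (pos _).ne' (pos _).ne', mul_comm
      (padeDen s (j + t + 1) : ℝ) (padeNum s (j + t)), hdet, abs_div, abs_mul, abs_pow, abs_neg,
      abs_one, one_pow, mul_one, abs_two, abs_of_pos (mul_pos (pos _) (pos _)), one_div, inv_pow,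
      ← div_eq_mul_inv, div_div, mul_comm (padeDen s (j + t + 1) : ℝ)]
    refine div_le_div_of_nonneg_left zero_le_two
      (mul_pos (mul_pos (pos _) (pos _)) (by positivity)) ?_
    linarith [hprod t]
  have hlim : Tendsto (fun t => (padeNum s (j + t) / padeDen s (j + t) : ℝ)) atTop
      (𝓝 (Real.exp (1 / s))) := by
    have := (tendsto_add_atTop_iff_nat j).2 (tendsto_padeNum_div_padeDen hs)
    simpa only [add_comm] using this
  have := dist_le_of_le_geometric_of_tendsto₀ _ _ (by norm_num) hdist hlim
  rw [add_zero, dist_comm, Real.dist_eq] at this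
  have e : padeDen s j * Real.exp (1 / s) - padeNum s j =
      padeDen s j * (Real.exp (1 / s) - padeNum s j / padeDen s j) := by
    rw [mul_sub, mul_div_cancel₀ _ (pos j).ne']
  rw [e, abs_mul, abs_of_pos (pos j)]
  refine (mul_le_mul_of_nonneg_left this (pos j).le).trans_eq ?_
  have := (pos j).ne'
  have := (pos (j + 1)).ne'
  field_simp
  norm_num

/-! ### Vanishing of the constant and divisibility of denominators -/

lemma inhomApproxConst_eq_zero_iff (θ φ : ℝ) : inhomApproxConst θ φ = 0 ↔
    ∀ ε : ℝ, 0 < ε → ∀ M : ℤ, ∃ q : ℤ, M ≤ |q| ∧ |(q : ℝ)| * distNearestInt (q * θ - φ) < ε := by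
  have basis : (comap (fun q : ℤ => |q|) atTop).HasBasis (fun _ : ℤ => True)
      (fun M => {q : ℤ | M ≤ |q|}) := atTop_basis.comap _
  constructor
  · intro h ε hε M
    have hlt : inhomApproxConst θ φ < ENNReal.ofReal ε := by
      rw [h]; exact ENNReal.ofReal_pos.2 hε
    obtain ⟨q, hq, hq'⟩ := basis.frequently_iff.1 (frequently_lt_of_liminf_lt (by isBoundedDefault)
      hlt) (i := M) trivial
    exact ⟨q, hq, (ENNReal.ofReal_lt_ofReal_iff hε).1 hq'⟩
  · intro h
    refine nonpos_iff_eq_zero.1 (ENNReal.le_of_forall_pos_le_add fun ε hε _ => ?_)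
    rw [zero_add]
    refine liminf_le_of_frequently_le (basis.frequently_iff.2 fun {M} _ => ?_)
      (by isBoundedDefault)
    obtain ⟨q, hq, hq'⟩ := h ε hε M
    exact ⟨q, hq, by simpa using ENNReal.ofReal_le_ofReal hq'.le⟩

lemma exists_dvd_padeDen {s : ℕ} (hs : 0 < s) {n : ℤ} (hn : n ≠ 0)
    (h : inhomApproxConst (Real.exp (1 / s)) (1 / n) = 0) : ∃ j, n ∣ padeDen s j := by
  set θ := Real.exp (1 / s)
  have hnR : (n : ℝ) ≠ 0 := by exact_mod_cast hn
  -- Chosen to give `|Q| |Q θ - P| < 1 / 32`; the bound 1 only excludes `q = 0`.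
  obtain ⟨q, hq, hε⟩ := (inhomApproxConst_eq_zero_iff _ _).1 h (1 / (32 * n ^ 2))
    (by positivity) 1
  set p := round ((q : ℝ) * θ - 1 / n)
  have hq0 : q ≠ 0 := by rintro rfl; simp at hq
  set Q := n * q
  set P := n * p + 1
  have hQ : 1 ≤ |Q| := Int.one_le_abs (mul_ne_zero hn hq0)
  have hQR : (0 : ℝ) < |(Q : ℝ)| := abs_pos.2 (by exact_mod_cast mul_ne_zero hn hq0)
  have hsmall : |(Q : ℝ)| * |Q * θ - P| < 1 / 32 := by
    have e : |(Q : ℝ)| * |Q * θ - P| = n ^ 2 * (|(q : ℝ)| * |q * θ - 1 / n - p|) := by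
      have : (Q * θ - P : ℝ) = n * (q * θ - 1 / n - p) := by
        simp only [Q, P]; push_cast; field_simp; ring
      rw [this, abs_mul, ← sq_abs (n : ℝ)]
      simp only [Q]; push_cast; rw [abs_mul]; ring
    rw [e]
    refine (mul_lt_mul_of_pos_left hε (by positivity)).trans_eq ?_
    field_simp
  -- The cutoff `16 |Q|` makes the two errors below at most `4 / 16` and `16 / 32`, with sum under
  -- 1.
  obtain ⟨j, hj, hj'⟩ : ∃ j, padeDen s j ≤ 16 * |Q| ∧ 16 * |Q| < padeDen s (j + 1) := by
    have hex : ∃ j, 16 * |Q| < padeDen s j :=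
      ⟨(16 * |Q| + 1).toNat, by have := padeDen_ge hs (16 * |Q| + 1).toNat; omega⟩
    classical
    obtain ⟨m, hm⟩ : ∃ m, Nat.find hex = m + 1 := by
      refine Nat.exists_eq_succ_of_ne_zero fun h0 => ?_
      have := Nat.find_spec hex
      rw [h0, padeDen, besselVal_zero] at this
      norm_num at this
      omega
    refine ⟨m, not_lt.1 (Nat.find_min hex (by omega)), ?_⟩
    rw [← hm]
    exact Nat.find_spec hex
  refine ⟨j, ?_⟩
  have hD : (0 : ℝ) < padeDen s j := by exact_mod_cast padeDen_pos hs j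
  have hD' : (0 : ℝ) < padeDen s (j + 1) := by exact_mod_cast padeDen_pos hs (j + 1)
  have hjR : (padeDen s j : ℝ) ≤ 16 * |(Q : ℝ)| := by exact_mod_cast hj
  have hjR' : 16 * |(Q : ℝ)| < padeDen s (j + 1) := by exact_mod_cast hj'
  have hzero : P * padeDen s j - Q * padeNum s j = 0 := by
    rw [← Int.abs_lt_one_iff]
    have e : (P * padeDen s j - Q * padeNum s j : ℝ) =
        Q * (padeDen s j * θ - padeNum s j) - padeDen s j * (Q * θ - P) := by ring
    have b1 : |(Q : ℝ) * (padeDen s j * θ - padeNum s j)| ≤ 1 / 4 := by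
      rw [abs_mul]
      refine (mul_le_mul_of_nonneg_left (abs_padeDen_mul_exp_sub_le hs j) hQR.le).trans ?_
      rw [mul_div_assoc', div_le_iff₀ hD']
      linarith
    have b2 : |(padeDen s j : ℝ) * (Q * θ - P)| ≤ 1 / 2 := by
      rw [abs_mul, abs_of_pos hD]
      refine (mul_le_mul_of_nonneg_right hjR (abs_nonneg _)).trans ?_
      linarith
    have : |(P * padeDen s j - Q * padeNum s j : ℝ)| < 1 := by
      rw [e]
      refine (abs_sub _ _).trans_lt ?_
      linarith
    exact_mod_cast this
  have hcop : IsCoprime n P := ⟨-p, 1, by simp only [P]; ring⟩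
  refine hcop.dvd_of_dvd_mul_left ⟨q * padeNum s j, ?_⟩
  linear_combination hzero

lemma inhomApproxConst_eq_zero_of_dvd_padeDen {s : ℕ} (hs : 0 < s) {n : ℤ} (hn : n ≠ 0)
    (h : ∀ J, ∃ j, J ≤ j ∧ n ∣ padeDen s j) :
    inhomApproxConst (Real.exp (1 / s)) (1 / n) = 0 := by
  rw [inhomApproxConst_eq_zero_iff]
  intro ε hε M
  set θ := Real.exp (1 / s)
  have hnR : (0 : ℝ) < |(n : ℝ)| := abs_pos.2 (by exact_mod_cast hn)
  obtain ⟨J, hJ⟩ := exists_nat_gt (16 / ε)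
  obtain ⟨j, hj, d, hd⟩ := h (J + M.toNat + 1)
  obtain ⟨a, b, hab⟩ := isCoprime_padeNum (Dvd.intro d hd.symm)
  have hnZ : 0 < |n| := abs_pos.2 hn
  -- An inverse of `N_j` mod `n`, shifted so that `m ≥ |n|` keeps `|m d| ≥ D_j` large, while `m ≤ 2
  -- |n|` controls the error.
  obtain ⟨m, p, hmp, hm1, hm2⟩ : ∃ m p, m * padeNum s j = n * p + 1 ∧ |n| ≤ m ∧ m ≤ 2 * |n| := by
    have h1 := Int.emod_nonneg a hn
    have h2 := Int.emod_lt_abs a hn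
    have h3 := Int.emod_add_mul_ediv a n
    refine ⟨a % n + |n|, (n.sign - a / n) * padeNum s j - b, ?_, by omega, by omega⟩
    have h4 : |n| = n * n.sign := (Int.abs_eq_natAbs n).trans (Int.mul_sign_self n).symm
    linear_combination padeNum s j * h3 + padeNum s j * h4 + hab
  have hDj := padeDen_ge hs j
  have hm0 : (0 : ℝ) < m := by exact_mod_cast hnZ.trans_le hm1
  have hm2R : (m : ℝ) ≤ 2 * |(n : ℝ)| := by exact_mod_cast hm2
  have hdR : (padeDen s j : ℝ) = n * d := by exact_mod_cast hd
  have hD : (0 : ℝ) < padeDen s j := by exact_mod_cast padeDen_pos hs j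
  have hn0 : (n : ℝ) ≠ 0 := by exact_mod_cast hn
  refine ⟨m * d, ?_, ?_⟩
  · rw [abs_mul]
    have : padeDen s j ≤ |m| * |d| := by
      rw [← abs_of_pos (padeDen_pos hs j), hd, abs_mul]
      exact mul_le_mul_of_nonneg_right (hm1.trans (le_abs_self m)) (abs_nonneg _)
    omega
  · have hle : distNearestInt (((m * d : ℤ) : ℝ) * θ - 1 / n) ≤
        |((m * d : ℤ) : ℝ) * θ - 1 / n - p| := round_le _ _
    have e : ((m * d : ℤ) : ℝ) * θ - 1 / n - p = m / n * (padeDen s j * θ - padeNum s j) := by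
      have : (m * padeNum s j : ℝ) = n * p + 1 := by exact_mod_cast hmp
      rw [hdR]
      push_cast
      field_simp
      linear_combination this
    have e' : |((m * d : ℤ) : ℝ)| = m / |(n : ℝ)| * padeDen s j := by
      rw [← abs_of_pos hD, hdR, abs_mul]
      push_cast
      rw [abs_mul, abs_of_pos hm0]
      field_simp
    rw [e, abs_mul, abs_div, abs_of_pos hm0] at hle
    rw [e']
    have hr : m / |(n : ℝ)| ≤ 2 := by rwa [div_le_iff₀ hnR]
    have hr0 : 0 ≤ m / |(n : ℝ)| := by positivity
    obtain ⟨i, rfl⟩ : ∃ i, j = i + 1 := ⟨j - 1, by omega⟩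
    have hJi : (J : ℝ) ≤ i := by exact_mod_cast (by omega : J ≤ i)
    have hg : ((i : ℝ) + 2) * padeDen s (i + 1) ≤ padeDen s (i + 2) := by
      exact_mod_cast padeDen_growth hs i
    have hD2 : (0 : ℝ) < padeDen s (i + 2) := by exact_mod_cast padeDen_pos hs (i + 2)
    have hε' : 16 < ε * i := by
      have := (div_lt_iff₀ hε).1 hJ
      nlinarith
    calc _ ≤ m / |(n : ℝ)| * padeDen s (i + 1) * (m / |(n : ℝ)| * (4 / padeDen s (i + 2))) := by
          refine mul_le_mul_of_nonneg_left (hle.trans ?_) (by positivity)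
          exact mul_le_mul_of_nonneg_left (abs_padeDen_mul_exp_sub_le hs (i + 1)) hr0
      _ ≤ 2 * padeDen s (i + 1) * (2 * (4 / padeDen s (i + 2))) := by gcongr
      _ = 16 * padeDen s (i + 1) / padeDen s (i + 2) := by ring
      _ < ε := by
          rw [div_lt_iff₀ hD2]
          nlinarith [mul_le_mul_of_nonneg_left hg hε.le, mul_pos hε hD]

theorem theorem12 (s : ℕ) (hs : 0 < s) (n₁ n₂ : ℤ) (hn₁ : n₁ ≠ 0) (hn₂ : n₂ ≠ 0)
    (hcop : IsCoprime n₁ n₂)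
    (h₁ : inhomApproxConst (Real.exp (1 / (s : ℝ))) (1 / (n₁ : ℝ)) = 0)
    (h₂ : inhomApproxConst (Real.exp (1 / (s : ℝ))) (1 / (n₂ : ℝ)) = 0) :
    inhomApproxConst (Real.exp (1 / (s : ℝ))) (1 / ((n₁ : ℝ) * (n₂ : ℝ))) = 0 := by
  obtain ⟨j₁, hj₁⟩ := exists_dvd_padeDen hs hn₁ h₁
  obtain ⟨j₂, hj₂⟩ := exists_dvd_padeDen hs hn₂ h₂
  rw [← Int.cast_mul]
  refine inhomApproxConst_eq_zero_of_dvd_padeDen hs (mul_ne_zero hn₁ hn₂) fun J => ?_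
  have hper {n : ℤ} (hn : n ≠ 0) {i j : ℕ} (h : n ∣ padeDen s i) (hi : i ≤ j)
      (hij : i ≡ j [MOD n.natAbs]) : n ∣ padeDen s j := by
    obtain ⟨t, ht⟩ := (Nat.modEq_iff_dvd' hi).1 hij
    rw [dvd_padeDen_iff] at h ⊢
    rw [show j = i + n.natAbs * t by omega]
    exact dvd_besselVal_add_mul h t
  obtain ⟨k, hk₁, hk₂⟩ := Nat.chineseRemainder (Int.isCoprime_iff_nat_coprime.1 hcop) j₁ j₂
  set N := n₁.natAbs * n₂.natAbs with hN
  have hNpos : 1 ≤ N := Nat.mul_pos (Int.natAbs_pos.2 hn₁) (Int.natAbs_pos.2 hn₂)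
  -- Adding this multiple of both periods pushes the index past `J`, `j₁` and `j₂`; periodicity is
  -- only used forwards.
  have hle : J + j₁ + j₂ ≤ N * (J + j₁ + j₂) := Nat.le_mul_of_pos_left _ hNpos
  refine ⟨k + N * (J + j₁ + j₂), by omega, hcop.mul_dvd
    (hper hn₁ hj₁ (by omega) (hk₁.symm.trans ?_)) (hper hn₂ hj₂ (by omega) (hk₂.symm.trans ?_))⟩
  · rw [hN, mul_assoc]
    exact (Nat.add_mul_mod_self_left _ _ _).symm
  · rw [hN, mul_comm n₁.natAbs, mul_assoc]
    exact (Nat.add_mul_mod_self_left _ _ _).symm
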